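/- Let $A,B\in\mathbb{C}^{4\times 4}$ satisfy $\operatorname{tr}A=\operatorname{tr}B=0$ and $\operatorname{tr}A^\dagger A+\operatorname{tr}B^\dagger B=\frac14$, where $\dagger$ denotes the conjugate transpose. Suppose that $A$ is either normal or of the form $$A=\begin{pmatrix}0&a_1&0&0\\a_2&0&0&0\\0&0&0&a_3\\0&0&a_4&0\end{pmatrix}\qquad(a_1,a_2,a_3,a_4\in\mathbb{C}),$$ and that $B$ is either normal or of the form $$B=\begin{pmatrix}0&b_1&0&0\\b_2&0&0&0\\0&0&0&b_3\\0&0&b_4&0\end{pmatrix}\qquad(b_1,b_2,b_3,b_4\in\mathbb{C})$$ (the two alternatives being independent for $A$ and $B$). Let $X=A\otimes I_4+I_4\otimes B$, and let $\sigma_1\ge\sigma_2\ge\dots\ge\sigma_{16}\ge0$ be the singular values of $X$, counted with multiplicity. Then $$\sigma_1^2+\sigma_2^2\le\frac12 .$$ Consequently the supremum of $\sigma_1^2+\sigma_2^2$ over the family $\mathcal{P}$ of all such $X$ is at most $\frac12$. -/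

import Mathlib

open scoped Kronecker Matrix

/-- The Kronecker sum `A ⊗ I + I ⊗ B` of two complex `d × d` matrices. -/
def kroneckerSum {d : ℕ} (A B : Matrix (Fin d) (Fin d) ℂ) :
    Matrix (Fin d × Fin d) (Fin d × Fin d) ℂ :=
  A ⊗ₖ (1 : Matrix (Fin d) (Fin d) ℂ) + (1 : Matrix (Fin d) (Fin d) ℂ) ⊗ₖ B

/-- The `4 × 4` matrix with two anti-diagonal `2 × 2` blocks, filled by `a₁, a₂` and `a₃, a₄`. -/
def doubleSwap (a₁ a₂ a₃ a₄ : ℂ) : Matrix (Fin 4) (Fin 4) ℂ :=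
  !![0, a₁, 0, 0;
     a₂, 0, 0, 0;
     0, 0, 0, a₃;
     0, 0, a₄, 0]

/-- `A` is normal, or it has the double swap pattern for some complex entries. -/
def IsNormalOrDoubleSwap (A : Matrix (Fin 4) (Fin 4) ℂ) : Prop :=
  IsStarNormal A ∨ ∃ a₁ a₂ a₃ a₄ : ℂ, A = doubleSwap a₁ a₂ a₃ a₄

/-- The family `𝒫` of all `X = A ⊗ I + I ⊗ B` with `A`, `B` traceless complex `4 × 4` matrices,
`tr A†A + tr B†B = 1 / 4`, each of which is normal or has the double swap pattern. -/
def familyP : Set (Matrix (Fin 4 × Fin 4) (Fin 4 × Fin 4) ℂ) :=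
  {X | ∃ A B : Matrix (Fin 4) (Fin 4) ℂ,
    X = kroneckerSum A B ∧
    A.trace = 0 ∧ B.trace = 0 ∧
    (Aᴴ * A).trace + (Bᴴ * B).trace = 1 / 4 ∧
    IsNormalOrDoubleSwap A ∧ IsNormalOrDoubleSwap B}

/-- The `k`-th singular value of a square complex matrix, `k = 1, 2, …`, in descending order and
repeated according to multiplicity (Mathlib's sequence of singular values starts at index `0`). -/
noncomputable def sigma {n : Type*} [Fintype n] [DecidableEq n]
    (X : Matrix n n ℂ) (k : ℕ) : ℝ :=
  (Matrix.toEuclideanLin X).singularValues (k - 1)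

/-! Conjugating `X` by `U ⊗ₖ V` turns each normal summand into a diagonal one and keeps traces,
Frobenius norms and singular values. After permuting rows and columns, possibly differently, `X` is
then diagonal or block diagonal with `2 × 2` blocks. So it suffices to bound the sum of any two
eigenvalues of `XᴴX` at different positions by `2N`, where `N = ‖A‖² + ‖B‖² = 1/4` in Frobenius
norms.

For two double swaps every block has squared norm at most `N`, which is enough. A diagonal summand
needs its trace to vanish, through `norm_sq_pair_add_le_sum` and `norm_sq_le_sum`. The delicate
mixed case is two blocks with the same diagonal entry `a i`: the traces count `‖a i‖ ^ 2` four
times, while only the factor `8 / 3` is affordable. The sharper `eigenvalues_gram_two_le` settles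
it. -/

/-! ### Pair bounds for the spectrum of `XᴴX`. -/

theorem Multiset.exists_ne_of_map_univ_eq {α β γ : Type*} [Fintype α] [Fintype β] {f : α → γ} {g : β → γ}
    (h : Multiset.map f Finset.univ.val = Multiset.map g Finset.univ.val) {i j : α} (hij : i ≠ j) :
    ∃ k l : β, k ≠ l ∧ f i = g k ∧ f j = g l := by
  classical
  have hmem (a : α) : ∃ k, g k = f a := by
    have : f a ∈ Multiset.map g Finset.univ.val := h ▸ Multiset.mem_map_of_mem f (Finset.mem_univ a)
    simpa using this
  by_cases hf : f i = f j
  · have hc := congrArg (Multiset.count (f i)) h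
    simp only [Multiset.count_map] at hc
    have h1 : 1 < (Finset.univ.filter fun a => f i = f a).card :=
      Finset.one_lt_card.2 ⟨i, by simp, j, by simpa using hf, hij⟩
    have h2 : 1 < (Finset.univ.filter fun b => f i = g b).card := by
      exact lt_of_lt_of_eq h1 hc
    obtain ⟨k, hk, l, hl, hkl⟩ := Finset.one_lt_card.1 h2
    exact ⟨k, l, hkl, by simpa using hk, by rw [← hf]; simpa using hl⟩
  · obtain ⟨k, hk⟩ := hmem i
    obtain ⟨l, hl⟩ := hmem j
    exact ⟨k, l, fun e => hf (by rw [← hk, ← hl, e]), hk.symm, hl.symm⟩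

namespace Matrix

variable {m n o : Type*} [Fintype m] [DecidableEq m] [Fintype n] [DecidableEq n] [Fintype o]
  [DecidableEq o]

/-- The eigenvalues of `XᴴX` can be listed as `d`, so that any two of them at different
positions add up to at most `c`. -/
def GramPairBound (X : Matrix n n ℂ) (c : ℝ) : Prop :=
  ∃ d : n → ℝ, (Xᴴ * X).charpoly = ∏ i, (Polynomial.X - Polynomial.C (d i : ℂ)) ∧
    ∀ i j, i ≠ j → d i + d j ≤ c

/-- The sorted eigenvalues and the list `d` are the same multiset of roots, so the two largest
occupy two different positions of `d`, even when they coincide. No sorting of `d` is needed. -/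
theorem GramPairBound.sq_sigma_add_sq_sigma_le {X : Matrix n n ℂ} {c : ℝ} (h : GramPairBound X c)
    (hn : 2 ≤ Fintype.card n) : sigma X 1 ^ 2 + sigma X 2 ^ 2 ≤ c := by
  obtain ⟨d, hd, hc⟩ := h
  set T := toEuclideanLin X with hT
  have hfr : Module.finrank ℂ (EuclideanSpace ℂ n) = Fintype.card n := finrank_euclideanSpace
  have hchar : (LinearMap.adjoint T ∘ₗ T).charpoly = (Xᴴ * X).charpoly := by
    rw [hT, ← toEuclideanLin_conjTranspose_eq_adjoint, ← charpoly_toLin (Xᴴ * X) (PiLp.basisFun 2 ℂ n),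
      ← toLpLin_eq_toLin]
    congr 1
    simp [toLpLin_mul_same]
  have hroots := T.isSymmetric_adjoint_comp_self.roots_charpoly_eq_eigenvalues hfr
  rw [hchar, hd, Polynomial.roots_prod _ _ (Finset.prod_ne_zero_iff.2 fun i _ =>
    Polynomial.X_sub_C_ne_zero _)] at hroots
  simp only [Polynomial.roots_X_sub_C, Multiset.bind_singleton] at hroots
  obtain ⟨k, l, hkl, hk, hl⟩ := Multiset.exists_ne_of_map_univ_eq hroots.symm
    (i := ⟨0, by omega⟩) (j := ⟨1, by omega⟩) (by simp)
  simp only [Function.comp, Complex.coe_algebraMap, Complex.ofReal_inj] at hk hl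
  simp only [sigma, Nat.sub_self, Nat.reduceSub]
  rw [← hT, T.sq_singularValues_of_lt hfr (by omega), T.sq_singularValues_of_lt hfr (by omega), hk, hl]
  exact hc k l hkl

/-- The row relabelling `e` cancels in `XᴴX`, and `f` only conjugates it by a permutation; hence the
two may differ. -/
theorem GramPairBound.of_submatrix {X : Matrix n n ℂ} {c : ℝ} (e f : m ≃ n)
    (h : GramPairBound (X.submatrix e f) c) : GramPairBound X c := by
  obtain ⟨d, hd, hc⟩ := h
  refine ⟨d ∘ f.symm, ?_, fun i j hij => hc _ _ (f.symm.injective.ne hij)⟩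
  rw [conjTranspose_submatrix, submatrix_mul_equiv, ← charpoly_reindex f, reindex_apply,
    submatrix_submatrix] at hd
  simp only [Equiv.self_comp_symm, submatrix_id_id] at hd
  rw [hd]
  exact Fintype.prod_equiv f _ _ fun i => by simp

theorem GramPairBound.of_unitary_conj {X U : Matrix n n ℂ} {c : ℝ} (hU : U ∈ unitaryGroup n ℂ)
    (h : GramPairBound X c) : GramPairBound (U * X * Uᴴ) c := by
  obtain ⟨d, hd, hc⟩ := h
  refine ⟨d, ?_, hc⟩
  have hU' : Uᴴ * U = 1 := mem_unitaryGroup_iff'.1 hU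
  rw [← hd, conjTranspose_mul, conjTranspose_mul, conjTranspose_conjTranspose]
  have : U * (Xᴴ * Uᴴ) * (U * X * Uᴴ) = U * (Xᴴ * X * Uᴴ) := by
    calc _ = U * (Xᴴ * (Uᴴ * U) * X * Uᴴ) := by simp only [Matrix.mul_assoc]
      _ = _ := by rw [hU', Matrix.mul_one]
  rw [this, charpoly_mul_comm, Matrix.mul_assoc, hU', Matrix.mul_one]

theorem charpoly_blockDiagonal {R : Type*} [CommRing R] (M : o → Matrix m m R) :
    (blockDiagonal M).charpoly = ∏ k, (M k).charpoly := by
  simp only [charpoly]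
  rw [← det_blockDiagonal]
  congr 1
  ext ⟨i, k⟩ ⟨j, l⟩ : 2
  by_cases hkl : k = l
  · subst hkl
    by_cases hij : i = j <;> simp [blockDiagonal_apply, hij]
  · simp [blockDiagonal_apply, hkl]

theorem gramPairBound_diagonal (a : n → ℂ) {c : ℝ}
    (h : ∀ i j, i ≠ j → ‖a i‖ ^ 2 + ‖a j‖ ^ 2 ≤ c) : GramPairBound (diagonal a) c := by
  refine ⟨fun i => ‖a i‖ ^ 2, ?_, h⟩
  rw [diagonal_conjTranspose, diagonal_mul_diagonal, charpoly_diagonal]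
  simp [Complex.conj_mul']

theorem gramPairBound_blockDiagonal (M : o → Matrix (Fin 2) (Fin 2) ℂ) {c : ℝ}
    (hdiag : ∀ k, ((M k)ᴴ * M k).trace.re ≤ c)
    (hoff : ∀ k l, k ≠ l → ∀ s t, (isHermitian_conjTranspose_mul_self (M k)).eigenvalues s +
      (isHermitian_conjTranspose_mul_self (M l)).eigenvalues t ≤ c) :
    GramPairBound (blockDiagonal M) c := by
  refine ⟨fun p => (isHermitian_conjTranspose_mul_self (M p.2)).eigenvalues p.1, ?_, ?_⟩
  · rw [blockDiagonal_conjTranspose, ← blockDiagonal_mul, charpoly_blockDiagonal,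
      Fintype.prod_prod_type_right]
    exact Finset.prod_congr rfl fun k _ => (isHermitian_conjTranspose_mul_self (M k)).charpoly_eq
  · rintro ⟨s, k⟩ ⟨t, l⟩ hne
    by_cases hkl : k = l
    · subst hkl
      refine le_trans (le_of_eq ?_) (hdiag k)
      rw [(isHermitian_conjTranspose_mul_self (M k)).trace_eq_sum_eigenvalues]
      have hst : s ≠ t := fun h => hne (by rw [h])
      rw [Complex.re_sum, Fin.sum_univ_two]
      fin_cases s <;> fin_cases t
      · simp at hst
      · rfl
      · exact add_comm _ _
      · simp at hst
    · exact hoff k l hkl s t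

open scoped ComplexOrder in
theorem eigenvalues_gram_le_trace (M : Matrix n n ℂ) (s : n) :
    (isHermitian_conjTranspose_mul_self M).eigenvalues s ≤ (Mᴴ * M).trace.re := by
  rw [(isHermitian_conjTranspose_mul_self M).trace_eq_sum_eigenvalues, Complex.re_sum]
  simp only [RCLike.ofReal_eq_complex_ofReal, Complex.ofReal_re]
  exact Finset.single_le_sum (f := (isHermitian_conjTranspose_mul_self M).eigenvalues)
    (fun i _ => (posSemidef_conjTranspose_mul_self M).eigenvalues_nonneg i) (Finset.mem_univ s)

theorem trace_gram_two (a b c d : ℂ) : (!![a, b; c, d]ᴴ * !![a, b; c, d]).trace.re =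
    ‖a‖ ^ 2 + ‖b‖ ^ 2 + ‖c‖ ^ 2 + ‖d‖ ^ 2 := by
  simp [trace_fin_two, mul_apply, Fin.sum_univ_two, Complex.conj_mul']
  norm_cast
  ring

/-- With `t` the right-hand side, `t - λ₀` and `t - λ₁` have nonnegative sum and product, so neither
is negative. The coefficient `4 / 3` is the one that `norm_sq_le_sum` can absorb. -/
theorem eigenvalues_gram_two_le (a b c : ℂ) (s : Fin 2) :
    (isHermitian_conjTranspose_mul_self !![a, b; c, a]).eigenvalues s ≤
      4 / 3 * ‖a‖ ^ 2 + 2 * (‖b‖ ^ 2 + ‖c‖ ^ 2) := by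
  set H := isHermitian_conjTranspose_mul_self !![a, b; c, a]
  have htr : H.eigenvalues 0 + H.eigenvalues 1 = 2 * ‖a‖ ^ 2 + ‖b‖ ^ 2 + ‖c‖ ^ 2 := by
    have h1 := trace_gram_two a b c a
    rw [H.trace_eq_sum_eigenvalues] at h1
    simp at h1
    linarith
  have hdet : H.eigenvalues 0 * H.eigenvalues 1 = ‖a * a - b * c‖ ^ 2 := by
    have h1 := H.det_eq_prod_eigenvalues
    rw [det_mul, det_conjTranspose, det_fin_two_of] at h1
    simp only [RCLike.star_def, Complex.conj_mul', Fin.prod_univ_two] at h1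
    apply Complex.ofReal_injective
    push_cast
    exact h1.symm
  have hsub : (‖a‖ ^ 2 - ‖b‖ * ‖c‖) ^ 2 ≤ ‖a * a - b * c‖ ^ 2 := by
    have := abs_norm_sub_norm_le (a * a) (b * c)
    rw [norm_mul, norm_mul, ← sq] at this
    exact sq_le_sq.2 (by rwa [abs_norm])
  -- With `u = ‖a‖²`, `r = ‖b‖‖c‖`, `s = ‖b‖² + ‖c‖²`, the product is at least `u²/9 - 2ur + r² +
  -- 2s²`, and `s² ≥ 4r²` leaves `(u/3 - 3r)²`.
  have key : 0 ≤ (4 / 3 * ‖a‖ ^ 2 + 2 * (‖b‖ ^ 2 + ‖c‖ ^ 2) - H.eigenvalues 0) *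
      (4 / 3 * ‖a‖ ^ 2 + 2 * (‖b‖ ^ 2 + ‖c‖ ^ 2) - H.eigenvalues 1) := by
    have h2 : 2 * (‖b‖ * ‖c‖) ≤ ‖b‖ ^ 2 + ‖c‖ ^ 2 := by linarith [two_mul_le_add_sq ‖b‖ ‖c‖]
    have h3 : 0 ≤ ‖b‖ * ‖c‖ := by positivity
    have h4 : 4 * (‖b‖ * ‖c‖) ^ 2 ≤ (‖b‖ ^ 2 + ‖c‖ ^ 2) ^ 2 := by nlinarith
    nlinarith [sq_nonneg (‖a‖ ^ 2 / 3 - 3 * (‖b‖ * ‖c‖)), sq_nonneg ‖a‖]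
  have hsum : 0 ≤ (4 / 3 * ‖a‖ ^ 2 + 2 * (‖b‖ ^ 2 + ‖c‖ ^ 2) - H.eigenvalues 0) +
      (4 / 3 * ‖a‖ ^ 2 + 2 * (‖b‖ ^ 2 + ‖c‖ ^ 2) - H.eigenvalues 1) := by
    nlinarith [sq_nonneg ‖a‖, sq_nonneg ‖b‖, sq_nonneg ‖c‖]
  fin_cases s <;> simp only [Fin.zero_eta, Fin.mk_one] <;> by_contra! hlt <;> nlinarith

end Matrix

/-! ### Unitary diagonalization of normal matrices. -/

open Module.End in
theorem LinearMap.IsSymmetric.exists_joint_eigenbasis_of_commute {𝕜 E : Type*} [RCLike 𝕜]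
    [NormedAddCommGroup E] [InnerProductSpace 𝕜 E] [FiniteDimensional 𝕜 E] {S T : E →ₗ[𝕜] E}
    (hS : S.IsSymmetric) (hT : T.IsSymmetric) (hST : Commute S T) {k : ℕ}
    (hk : Module.finrank 𝕜 E = k) :
    ∃ b : OrthonormalBasis (Fin k) 𝕜 E, ∀ j, ∃ α β : 𝕜, S (b j) = α • b j ∧ T (b j) = β • b j := by
  classical
  have hfam := LinearMap.IsSymmetric.orthogonalFamily_eigenspace_inf_eigenspace hS hT
  have hint := DirectSum.isInternal_ne_bot_iff.2
    (LinearMap.IsSymmetric.directSum_isInternal_of_commute hS hT hST)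
  have horth := hfam.comp
    (Subtype.val_injective (p := fun i : 𝕜 × 𝕜 => eigenspace S i.2 ⊓ eigenspace T i.1 ≠ ⊥))
  have : Fintype {i : 𝕜 × 𝕜 // eigenspace S i.2 ⊓ eigenspace T i.1 ≠ ⊥} :=
    Set.Finite.fintype (WellFoundedGT.finite_ne_bot_of_iSupIndep hfam.independent)
  refine ⟨hint.subordinateOrthonormalBasis hk horth, fun j => ?_⟩
  have h := hint.subordinateOrthonormalBasis_subordinate hk j horth
  exact ⟨_, _, mem_eigenspace_iff.1 h.1, mem_eigenspace_iff.1 h.2⟩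

namespace Matrix

open ComplexStarModule in
/-- The spectral theorem for normal complex matrices. -/
theorem exists_unitary_diagonal_of_isStarNormal {n : Type*} [Fintype n] [DecidableEq n]
    (A : Matrix n n ℂ) (hA : IsStarNormal A) :
    ∃ U ∈ unitaryGroup n ℂ, ∃ d : n → ℂ, A = U * diagonal d * Uᴴ := by
  -- Normality makes the Hermitian real and imaginary parts commute, so they share an orthonormal
  -- eigenbasis.
  have hcomm : Commute (toEuclideanLin (ℜ A : Matrix n n ℂ)) (toEuclideanLin (ℑ A : Matrix n n ℂ)) := by
    have h := (Commute.realPart_imaginaryPart A).eq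
    change _ ∘ₗ _ = _ ∘ₗ _
    rw [← toLpLin_mul_same, ← toLpLin_mul_same, h]
  obtain ⟨b, hb⟩ := LinearMap.IsSymmetric.exists_joint_eigenbasis_of_commute
    (isSymmetric_toEuclideanLin_iff.2 (ℜ A).2) (isSymmetric_toEuclideanLin_iff.2 (ℑ A).2)
    hcomm finrank_euclideanSpace
  choose α β hα hβ using hb
  let e := Fintype.equivFin n
  have hdec : A = (ℜ A : Matrix n n ℂ) + Complex.I • (ℑ A : Matrix n n ℂ) :=
    (realPart_add_I_smul_imaginaryPart A).symm
  have hev (j : n) : A *ᵥ (b (e j)).ofLp = (α (e j) + Complex.I * β (e j)) • (b (e j)).ofLp := by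
    have h1 := congrArg WithLp.ofLp (hα (e j))
    have h2 := congrArg WithLp.ofLp (hβ (e j))
    simp only [ofLp_toLpLin, toLin'_apply, WithLp.ofLp_smul] at h1 h2
    conv_lhs => rw [hdec]
    rw [add_mulVec, smul_mulVec, h1, h2, add_smul, smul_smul]
  obtain ⟨U, hU, hUapp⟩ : ∃ U ∈ unitaryGroup n ℂ, ∀ i j, U i j = (b (e j)).ofLp i :=
    ⟨(EuclideanSpace.basisFun n ℂ).toBasis.toMatrix (b.reindex e.symm),
      OrthonormalBasis.toMatrix_orthonormalBasis_mem_unitary _ _,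
      fun i j => by simp [Module.Basis.toMatrix_apply]⟩
  refine ⟨U, hU, fun j => α (e j) + Complex.I * β (e j), ?_⟩
  have hAU : A * U = U * diagonal fun j => α (e j) + Complex.I * β (e j) := by
    ext i j
    have h := congrFun (hev j) i
    rw [mul_diagonal, hUapp, mul_comm]
    simpa [mul_apply, mulVec, dotProduct, hUapp] using h
  rw [← hAU, Matrix.mul_assoc, ← star_eq_conjTranspose, mem_unitaryGroup_iff.1 hU, Matrix.mul_one]

end Matrix

/-! ### Inequalities for four complex numbers with sum zero. -/

open Matrix

/-- The other two entries sum to `-(a i + a k)`, so their squared norms add up to at least `‖a i + a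
k‖ ^ 2 / 2`. -/
theorem norm_sq_pair_add_le_sum {a : Fin 4 → ℂ} (ha : ∑ i, a i = 0) {i k : Fin 4} (hik : i ≠ k) :
    ‖a i‖ ^ 2 + ‖a k‖ ^ 2 + ‖a i + a k‖ ^ 2 / 2 ≤ ∑ j, ‖a j‖ ^ 2 := by
  have hre := congrArg Complex.re ha
  have him := congrArg Complex.im ha
  have real (x : Fin 4 → ℝ) (hx : x 0 + x 1 + x 2 + x 3 = 0) :
      x i ^ 2 + x k ^ 2 + (x i + x k) ^ 2 / 2 ≤ x 0 ^ 2 + x 1 ^ 2 + x 2 ^ 2 + x 3 ^ 2 := by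
    have h3 : x 3 = -(x 0 + x 1 + x 2) := by linarith
    fin_cases i <;> fin_cases k <;> simp at hik <;> simp [h3] <;>
      nlinarith [sq_nonneg (x 0 - x 1), sq_nonneg (x 0 - x 2), sq_nonneg (x 1 - x 2),
        sq_nonneg (2 * x 0 + x 1 + x 2), sq_nonneg (x 0 + 2 * x 1 + x 2),
        sq_nonneg (x 0 + x 1 + 2 * x 2)]
  have h1 := real (fun j => (a j).re) (by simpa [Fin.sum_univ_four] using hre)
  have h2 := real (fun j => (a j).im) (by simpa [Fin.sum_univ_four] using him)
  simp only [Complex.sq_norm, Complex.normSq_apply, Fin.sum_univ_four, Complex.add_re,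
    Complex.add_im]
  linarith

/-- The other three entries sum to `-a i`; Cauchy–Schwarz gives the extra third. -/
theorem norm_sq_le_sum {a : Fin 4 → ℂ} (ha : ∑ i, a i = 0) (i : Fin 4) :
    4 / 3 * ‖a i‖ ^ 2 ≤ ∑ j, ‖a j‖ ^ 2 := by
  have hre := congrArg Complex.re ha
  have him := congrArg Complex.im ha
  have real (x : Fin 4 → ℝ) (hx : x 0 + x 1 + x 2 + x 3 = 0) :
      4 / 3 * x i ^ 2 ≤ x 0 ^ 2 + x 1 ^ 2 + x 2 ^ 2 + x 3 ^ 2 := by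
    fin_cases i
    · have h : x 0 = -(x 1 + x 2 + x 3) := by linarith
      simp [h]
      nlinarith [sq_nonneg (x 1 - x 2), sq_nonneg (x 1 - x 3), sq_nonneg (x 2 - x 3)]
    · have h : x 1 = -(x 0 + x 2 + x 3) := by linarith
      simp [h]
      nlinarith [sq_nonneg (x 0 - x 2), sq_nonneg (x 0 - x 3), sq_nonneg (x 2 - x 3)]
    · have h : x 2 = -(x 0 + x 1 + x 3) := by linarith
      simp [h]
      nlinarith [sq_nonneg (x 0 - x 1), sq_nonneg (x 0 - x 3), sq_nonneg (x 1 - x 3)]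
    · have h : x 3 = -(x 0 + x 1 + x 2) := by linarith
      simp [h]
      nlinarith [sq_nonneg (x 0 - x 1), sq_nonneg (x 0 - x 2), sq_nonneg (x 1 - x 2)]
  have h1 := real (fun j => (a j).re) (by simpa [Fin.sum_univ_four] using hre)
  have h2 := real (fun j => (a j).im) (by simpa [Fin.sum_univ_four] using him)
  simp only [Complex.sq_norm, Complex.normSq_apply, Fin.sum_univ_four] at h1 h2 ⊢
  linarith

theorem norm_add_sq_le_two_mul (z w : ℂ) : ‖z + w‖ ^ 2 ≤ 2 * (‖z‖ ^ 2 + ‖w‖ ^ 2) := by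
  have := parallelogram_law_with_norm ℝ z w
  nlinarith [sq_nonneg ‖z - w‖]

theorem norm_add_sq_add_norm_add_sq_le {b : Fin 4 → ℂ} (hb : ∑ i, b i = 0) (z : ℂ) {j l : Fin 4}
    (hjl : j ≠ l) :
    ‖z + b j‖ ^ 2 + ‖z + b l‖ ^ 2 ≤ 2 * (4 / 3 * ‖z‖ ^ 2 + ∑ i, ‖b i‖ ^ 2) := by
  have h := norm_sq_pair_add_le_sum hb hjl
  refine le_trans ?_ (mul_le_mul_of_nonneg_left (add_le_add_right h _) zero_le_two)
  simp only [Complex.sq_norm, Complex.normSq_apply, Complex.add_re, Complex.add_im]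
  -- The gap between the two sides is `‖2z - 3(b j + b l)‖²/6 + ‖b j - b l‖²/2`.
  nlinarith [sq_nonneg (2 * z.re - 3 * ((b j).re + (b l).re)), sq_nonneg ((b j).re - (b l).re),
    sq_nonneg (2 * z.im - 3 * ((b j).im + (b l).im)), sq_nonneg ((b j).im - (b l).im)]

/-! ### The three canonical cases. -/

theorem gramPairBound_kroneckerSum_diagonal_diagonal {a b : Fin 4 → ℂ} (ha : ∑ i, a i = 0)
    (hb : ∑ i, b i = 0) : GramPairBound (kroneckerSum (diagonal a) (diagonal b))
      (2 * (∑ i, ‖a i‖ ^ 2 + ∑ i, ‖b i‖ ^ 2)) := by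
  have hX : kroneckerSum (diagonal a) (diagonal b) = diagonal fun p => a p.1 + b p.2 := by
    rw [kroneckerSum, ← diagonal_one, diagonal_kronecker_diagonal, diagonal_kronecker_diagonal,
      diagonal_add]
    simp
  rw [hX]
  refine gramPairBound_diagonal _ ?_
  rintro ⟨i, j⟩ ⟨k, l⟩ hne
  by_cases hik : i = k
  · subst hik
    have hjl : j ≠ l := fun h => hne (by rw [h])
    have := norm_add_sq_add_norm_add_sq_le hb (a i) hjl
    linarith [norm_sq_le_sum ha i]
  · by_cases hjl : j = l
    · subst hjl
      have := norm_add_sq_add_norm_add_sq_le ha (b j) hik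
      rw [add_comm (b j), add_comm (b j)] at this
      linarith [norm_sq_le_sum hb j]
    · linarith [norm_sq_pair_add_le_sum ha hik, norm_sq_pair_add_le_sum hb hjl,
        norm_add_sq_le_two_mul (a i) (b j), norm_add_sq_le_two_mul (a k) (b l),
        sq_nonneg ‖a i + a k‖, sq_nonneg ‖b j + b l‖]

theorem doubleSwap_finProdFinEquiv (α : Fin 2 → Fin 2 → ℂ) (x y z w : Fin 2) :
    doubleSwap (α 0 0) (α 0 1) (α 1 0) (α 1 1) (finProdFinEquiv (x, y)) (finProdFinEquiv (z, w)) =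
      if x = z ∧ y ≠ w then α x y else 0 := by
  fin_cases x <;> fin_cases y <;> fin_cases z <;> fin_cases w <;>
    simp [doubleSwap, finProdFinEquiv]

theorem gramPairBound_kroneckerSum_diagonal_doubleSwap {a : Fin 4 → ℂ} (ha : ∑ i, a i = 0)
    (α : Fin 2 → Fin 2 → ℂ) :
    GramPairBound (kroneckerSum (diagonal a) (doubleSwap (α 0 0) (α 0 1) (α 1 0) (α 1 1)))
      (2 * (∑ i, ‖a i‖ ^ 2 + ∑ x, ∑ y, ‖α x y‖ ^ 2)) := by
  -- The position inside a swapped pair becomes the index within a block; the diagonal index and the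
  -- choice of pair label the blocks.
  let e : Fin 2 × (Fin 4 × Fin 2) ≃ Fin 4 × Fin 4 :=
    { toFun := fun p => (p.2.1, finProdFinEquiv (p.2.2, p.1))
      invFun := fun q => ((finProdFinEquiv (m := 2) (n := 2).symm q.2).2,
        (q.1, (finProdFinEquiv (m := 2) (n := 2).symm q.2).1))
      left_inv := fun p => by simp
      right_inv := fun q => by simp }
  apply GramPairBound.of_submatrix e e
  have hX : (kroneckerSum (diagonal a) (doubleSwap (α 0 0) (α 0 1) (α 1 0) (α 1 1))).submatrix e e =
      blockDiagonal fun p : Fin 4 × Fin 2 => !![a p.1, α p.2 0; α p.2 1, a p.1] := by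
    ext ⟨y, i, x⟩ ⟨z, k, w⟩
    simp only [e, kroneckerSum, submatrix_apply, Equiv.coe_fn_mk, Matrix.add_apply, kroneckerMap_apply,
      doubleSwap_finProdFinEquiv, blockDiagonal_apply, diagonal_apply, one_apply,
      EmbeddingLike.apply_eq_iff_eq, Prod.mk.injEq]
    by_cases hik : i = k <;> by_cases hxw : x = w <;> fin_cases y <;> fin_cases z <;>
      simp [hik, hxw]
  have hα : 0 ≤ ∑ x, ∑ y, ‖α x y‖ ^ 2 := by positivity
  have hsum : ∑ x, ∑ y, ‖α x y‖ ^ 2 =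
      ‖α 0 0‖ ^ 2 + ‖α 0 1‖ ^ 2 + (‖α 1 0‖ ^ 2 + ‖α 1 1‖ ^ 2) := by simp [Fin.sum_univ_two]
  have hrow (x : Fin 2) : ‖α x 0‖ ^ 2 + ‖α x 1‖ ^ 2 ≤ ∑ x, ∑ y, ‖α x y‖ ^ 2 := by
    rw [hsum]
    fin_cases x <;> simp <;> positivity
  have hrows {x w : Fin 2} (h : x ≠ w) : ‖α x 0‖ ^ 2 + ‖α x 1‖ ^ 2 +
      (‖α w 0‖ ^ 2 + ‖α w 1‖ ^ 2) = ∑ x, ∑ y, ‖α x y‖ ^ 2 := by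
    rw [hsum]
    fin_cases x <;> fin_cases w <;> (simp at h ⊢; try ring)
  rw [hX]
  refine gramPairBound_blockDiagonal _ ?_ ?_
  · rintro ⟨i, x⟩
    rw [trace_gram_two]
    dsimp only
    linarith [norm_sq_le_sum ha i, hrow x, sq_nonneg ‖a i‖]
  · rintro ⟨i, x⟩ ⟨k, w⟩ hne s t
    by_cases hik : i = k
    · subst hik
      have hxw : x ≠ w := fun h => hne (by rw [h])
      have h1 := eigenvalues_gram_two_le (a i) (α x 0) (α x 1) s
      have h2 := eigenvalues_gram_two_le (a i) (α w 0) (α w 1) t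
      linarith [norm_sq_le_sum ha i, hrows hxw]
    · have h1 := eigenvalues_gram_le_trace !![a i, α x 0; α x 1, a i] s
      have h2 := eigenvalues_gram_le_trace !![a k, α w 0; α w 1, a k] t
      rw [trace_gram_two] at h1 h2
      linarith [norm_sq_pair_add_le_sum ha hik, hrow x, hrow w, sq_nonneg ‖a i + a k‖]

theorem gramPairBound_kroneckerSum_doubleSwap_doubleSwap (α β : Fin 2 → Fin 2 → ℂ) :
    GramPairBound (kroneckerSum (doubleSwap (α 0 0) (α 0 1) (α 1 0) (α 1 1))
      (doubleSwap (β 0 0) (β 0 1) (β 1 0) (β 1 1)))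
      (2 * (∑ x, ∑ y, ‖α x y‖ ^ 2 + ∑ x, ∑ y, ‖β x y‖ ^ 2)) := by
  -- Each summand flips one of the two positions inside the pairs, so `X` reverses the parity of
  -- their sum. Shifting that parity by `t = 1` on rows and `t = 0` on columns makes `X` block
  -- diagonal.
  let e (t : Fin 2) : Fin 2 × ((Fin 2 × Fin 2) × Fin 2) ≃ Fin 4 × Fin 4 :=
    { toFun := fun p => (finProdFinEquiv (p.2.1.1, p.1), finProdFinEquiv (p.2.1.2, p.1 + p.2.2 + t))
      invFun := fun q => ((finProdFinEquiv (m := 2) (n := 2).symm q.1).2,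
        (((finProdFinEquiv (m := 2) (n := 2).symm q.1).1,
          (finProdFinEquiv (m := 2) (n := 2).symm q.2).1),
          (finProdFinEquiv (m := 2) (n := 2).symm q.2).2 -
            (finProdFinEquiv (m := 2) (n := 2).symm q.1).2 - t))
      left_inv := fun ⟨y, ⟨x, w⟩, p⟩ => by
        simp only [Equiv.symm_apply_apply, Prod.mk.injEq, true_and]
        abel
      right_inv := fun q => by
        simp only [add_assoc, sub_add_cancel, add_sub_cancel, Prod.mk.eta,
          Equiv.apply_symm_apply] }
  apply GramPairBound.of_submatrix (e 1) (e 0)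
  have hX : (kroneckerSum (doubleSwap (α 0 0) (α 0 1) (α 1 0) (α 1 1))
      (doubleSwap (β 0 0) (β 0 1) (β 1 0) (β 1 1))).submatrix (e 1) (e 0) =
      blockDiagonal fun p : (Fin 2 × Fin 2) × Fin 2 =>
        !![β p.1.2 (p.2 + 1), α p.1.1 0; α p.1.1 1, β p.1.2 p.2] := by
    ext ⟨y, ⟨x, w⟩, p⟩ ⟨z, ⟨x', w'⟩, p'⟩
    simp only [e, kroneckerSum, submatrix_apply, Equiv.coe_fn_mk, Matrix.add_apply, kroneckerMap_apply,
      doubleSwap_finProdFinEquiv, blockDiagonal_apply, one_apply,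
      EmbeddingLike.apply_eq_iff_eq, Prod.mk.injEq]
    by_cases hx : x = x' <;> by_cases hw : w = w' <;> fin_cases p <;> fin_cases p' <;>
      fin_cases y <;> fin_cases z <;> simp [hx, hw]
  have htr (x w p : Fin 2) : ‖β w (p + 1)‖ ^ 2 + ‖α x 0‖ ^ 2 + ‖α x 1‖ ^ 2 + ‖β w p‖ ^ 2 ≤
      ∑ x, ∑ y, ‖α x y‖ ^ 2 + ∑ x, ∑ y, ‖β x y‖ ^ 2 := by
    simp only [Fin.sum_univ_two]
    fin_cases x <;> fin_cases w <;> fin_cases p <;> simp <;>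
      linarith [sq_nonneg ‖α 0 0‖, sq_nonneg ‖α 0 1‖, sq_nonneg ‖α 1 0‖, sq_nonneg ‖α 1 1‖,
        sq_nonneg ‖β 0 0‖, sq_nonneg ‖β 0 1‖, sq_nonneg ‖β 1 0‖, sq_nonneg ‖β 1 1‖]
  rw [hX]
  refine gramPairBound_blockDiagonal _ ?_ ?_
  · rintro ⟨⟨x, w⟩, p⟩
    rw [trace_gram_two]
    dsimp only
    linarith [htr x w p, show 0 ≤ ∑ x, ∑ y, ‖α x y‖ ^ 2 + ∑ x, ∑ y, ‖β x y‖ ^ 2 by positivity]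
  · rintro ⟨⟨x, w⟩, p⟩ ⟨⟨x', w'⟩, p'⟩ - s t
    have h1 := eigenvalues_gram_le_trace !![β w (p + 1), α x 0; α x 1, β w p] s
    have h2 := eigenvalues_gram_le_trace !![β w' (p' + 1), α x' 0; α x' 1, β w' p'] t
    rw [trace_gram_two] at h1 h2
    linarith [htr x w p, htr x' w' p']

/-! ### Symmetries and reduction to the canonical cases. -/

theorem Matrix.GramPairBound.kroneckerSum_comm {d : ℕ} {A B : Matrix (Fin d) (Fin d) ℂ} {c : ℝ}
    (h : GramPairBound (kroneckerSum A B) c) : GramPairBound (kroneckerSum B A) c := by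
  refine GramPairBound.of_submatrix (Equiv.prodComm _ _) (Equiv.prodComm _ _) ?_
  convert h using 1
  ext ⟨i, j⟩ ⟨k, l⟩
  simp [kroneckerSum, one_apply, add_comm]

theorem kroneckerSum_unitary_conj {d : ℕ} {U V : Matrix (Fin d) (Fin d) ℂ}
    (hU : U ∈ unitaryGroup (Fin d) ℂ) (hV : V ∈ unitaryGroup (Fin d) ℂ)
    (A B : Matrix (Fin d) (Fin d) ℂ) :
    kroneckerSum (U * A * Uᴴ) (V * B * Vᴴ) = (U ⊗ₖ V) * kroneckerSum A B * (U ⊗ₖ V)ᴴ := by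
  have hU' : U * Uᴴ = 1 := mem_unitaryGroup_iff.1 hU
  have hV' : V * Vᴴ = 1 := mem_unitaryGroup_iff.1 hV
  simp only [kroneckerSum, conjTranspose_kronecker, Matrix.mul_add, Matrix.add_mul,
    ← mul_kronecker_mul, Matrix.mul_one, hU', hV']

theorem trace_unitary_conj {d : ℕ} {U : Matrix (Fin d) (Fin d) ℂ}
    (hU : U ∈ unitaryGroup (Fin d) ℂ) (A : Matrix (Fin d) (Fin d) ℂ) :
    (U * A * Uᴴ).trace = A.trace := by
  rw [trace_mul_comm, ← Matrix.mul_assoc, ← star_eq_conjTranspose, mem_unitaryGroup_iff'.1 hU,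
    Matrix.one_mul]

theorem trace_gram_unitary_conj {d : ℕ} {U : Matrix (Fin d) (Fin d) ℂ}
    (hU : U ∈ unitaryGroup (Fin d) ℂ) (A : Matrix (Fin d) (Fin d) ℂ) :
    ((U * A * Uᴴ)ᴴ * (U * A * Uᴴ)).trace = (Aᴴ * A).trace := by
  have hU' : Uᴴ * U = 1 := mem_unitaryGroup_iff'.1 hU
  rw [← trace_unitary_conj hU (Aᴴ * A)]
  congr 1
  calc _ = U * (Aᴴ * (Uᴴ * U) * A) * Uᴴ := by
        simp only [conjTranspose_mul, conjTranspose_conjTranspose, Matrix.mul_assoc]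
    _ = _ := by rw [hU', Matrix.mul_one]

theorem trace_gram_diagonal (a : Fin 4 → ℂ) :
    ((diagonal a)ᴴ * diagonal a).trace.re = ∑ i, ‖a i‖ ^ 2 := by
  rw [diagonal_conjTranspose, diagonal_mul_diagonal, trace_diagonal, Complex.re_sum]
  refine Finset.sum_congr rfl fun i _ => ?_
  rw [Pi.star_apply, Complex.star_def, Complex.conj_mul', ← Complex.ofReal_pow, Complex.ofReal_re]

theorem trace_gram_doubleSwap (α : Fin 2 → Fin 2 → ℂ) :
    ((doubleSwap (α 0 0) (α 0 1) (α 1 0) (α 1 1))ᴴ *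
      doubleSwap (α 0 0) (α 0 1) (α 1 0) (α 1 1)).trace.re = ∑ x, ∑ y, ‖α x y‖ ^ 2 := by
  simp [doubleSwap, trace, mul_apply, Fin.sum_univ_four, Complex.conj_mul']
  norm_cast
  ring

theorem IsNormalOrDoubleSwap.exists_canonical {A : Matrix (Fin 4) (Fin 4) ℂ}
    (hA : IsNormalOrDoubleSwap A) :
    ∃ U ∈ unitaryGroup (Fin 4) ℂ, ∃ D, A = U * D * Uᴴ ∧ ((∃ a, D = diagonal a) ∨
      ∃ α : Fin 2 → Fin 2 → ℂ, D = doubleSwap (α 0 0) (α 0 1) (α 1 0) (α 1 1)) := by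
  rcases hA with hA | ⟨a₁, a₂, a₃, a₄, rfl⟩
  · obtain ⟨U, hU, a, h⟩ := exists_unitary_diagonal_of_isStarNormal A hA
    exact ⟨U, hU, _, h, .inl ⟨a, rfl⟩⟩
  · exact ⟨1, one_mem _, _, by simp, .inr ⟨![![a₁, a₂], ![a₃, a₄]], rfl⟩⟩

theorem theorem1 (X : Matrix (Fin 4 × Fin 4) (Fin 4 × Fin 4) ℂ) (hX : X ∈ familyP) :
    sigma X 1 ^ 2 + sigma X 2 ^ 2 ≤ 1 / 2 := by
  obtain ⟨A, B, rfl, hA0, hB0, hAB, hA, hB⟩ := hX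
  refine GramPairBound.sq_sigma_add_sq_sigma_le ?_ (by simp)
  obtain ⟨U, hU, D, rfl, hD⟩ := hA.exists_canonical
  obtain ⟨V, hV, F, rfl, hF⟩ := hB.exists_canonical
  rw [kroneckerSum_unitary_conj hU hV]
  refine GramPairBound.of_unitary_conj (kronecker_mem_unitary hU hV) ?_
  rw [trace_unitary_conj hU] at hA0
  rw [trace_unitary_conj hV] at hB0
  rw [trace_gram_unitary_conj hU, trace_gram_unitary_conj hV] at hAB
  -- Rewriting `1 / 2` as twice the total squared norm gives the homogeneous form proved in each
  -- case.
  have hnorm : (1 / 2 : ℝ) = 2 * ((Dᴴ * D).trace.re + (Fᴴ * F).trace.re) := by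
    have := congrArg Complex.re hAB
    norm_num at this
    linarith
  rw [hnorm]
  rcases hD with ⟨a, rfl⟩ | ⟨α, rfl⟩ <;> rcases hF with ⟨b, rfl⟩ | ⟨β, rfl⟩ <;>
    simp only [trace_gram_diagonal, trace_gram_doubleSwap]
  · exact gramPairBound_kroneckerSum_diagonal_diagonal (by rwa [trace_diagonal] at hA0)
      (by rwa [trace_diagonal] at hB0)
  · exact gramPairBound_kroneckerSum_diagonal_doubleSwap (by rwa [trace_diagonal] at hA0) β
  · rw [add_comm (∑ x, ∑ y, ‖α x y‖ ^ 2)]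
    exact (gramPairBound_kroneckerSum_diagonal_doubleSwap (by rwa [trace_diagonal] at hB0)
      α).kroneckerSum_comm
  · exact gramPairBound_kroneckerSum_doubleSwap_doubleSwap α β
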